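/- Let $\mathcal A$ be a non-empty compact Hausdorff space, let $\mathcal A^+=\bigsqcup_{n\ge 1}\mathcal A^n$ be the space of finite non-empty words over $\mathcal A$, and let $\varrho\colon\mathcal A\to\mathcal A^+$ be a continuous map (a substitution), extended to words by concatenation. Let $E=C(\mathcal A,\mathbb R)$ with the supremum norm, and let $M\colon E\to E$, $(Mf)(a)=\sum_{b\triangleleft\varrho(a)}f(b)$, where the sum runs over the letters of the word $\varrho(a)$ with multiplicity. Let $\sigma(M)\subset\mathbb C$ be the spectrum of (the complexification of) $M$, let $r$ be its spectral radius, put $T=M/r$, and let $$r_2=\sup\{|\lambda| : \lambda\in\sigma(M),\ \lambda\ne r\},\qquad \sup\varnothing:=0 .$$ Assume that (A1) $T$ is uniformly power convergent, i.e. $T^n$ converges in operator norm as $n\to\infty$; (A2) $T$ is irreducible, i.e. $\{0\}$ and $E$ are the only closed lattice ideals $I$ of $E$ with $T(I)\subseteq I$. Then there are a function $0\ne\ell\in E$, $\ell\ge 0$, with $M\ell=r\ell$ (a natural length function) and a positive functional $\mu\in E'$ with $\mu\circ T=\mu$ (an eigenmeasure) such that $\mu(\ell)=1$. For any such $\ell$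 and $\mu$, and for $f\in E$, $a\in\mathcal A$ and $n\in\mathbb N_0$, let $$\mathrm{Exp}(f,a,n)=r^n\,\ell(a)\,\mu(f),\qquad \mathrm{Act}(f,a,n)=\sum_{b\triangleleft\varrho^n(a)}f(b)=(M^nf)(a).$$ Then the following hold. 1. If $\sigma(M)\ne\{0,r\}$ (that is, if $r_2>0$ or $\sigma(M)=\{r\}$), there is a function $\theta\colon\mathbb N_0\to\mathbb R_{>0}$ with $\theta(n)^{1/n}\to 1$ as $n\to\infty$ such that for all $f\in E$ with $\|f\|\le 1$, all $a\in\mathcal A$ and all $n\in\mathbb N_0$ $$|\mathrm{Exp}(f,a,n)-\mathrm{Act}(f,a,n)|\le\theta(n)\,r_2^{\,n}.$$ 2. In all cases, for every $\epsilon>0$ there is $N$ such that for all $n\ge N$, all $f\in E$ with $\|f\|\le1$ and all $a\in\mathcal A$ $$|\mathrm{Exp}(f,a,n)-\mathrm{Act}(f,a,n)|\le(r_2+\epsilon)^n.$$ -/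

import Mathlib

open Filter Topology

noncomputable section

/-- The space `A⁺` of finite non-empty words over `A`: the disjoint union of the finite powers
`Aⁿ`, `n ≥ 1`, each with the product topology. -/
abbrev Word (A : Type*) : Type _ := Σ n : ℕ+, (Fin (n : ℕ) → A)

section Operator

variable {A : Type*} [TopologicalSpace A]

/-- A substitution on `A` is a continuous function `A → A⁺`. -/
abbrev Substitution (A : Type*) [TopologicalSpace A] : Type _ := C(A, Word A)

/-- `∑_{b ◁ u} f b`, the sum over the letters of the word `u`, with multiplicity. -/
def wordSum {𝕜 : Type*} [AddCommMonoid 𝕜] (f : A → 𝕜) (u : Word A) : 𝕜 := ∑ i, f (u.2 i)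

theorem continuous_wordSum {𝕜 : Type*} [RCLike 𝕜] (f : C(A, 𝕜)) :
    Continuous (wordSum (f : A → 𝕜)) := by
  refine continuous_sigma fun n => ?_
  change Continuous fun v : Fin (n : ℕ) → A => ∑ i, f (v i)
  fun_prop

variable [CompactSpace A]

/-- The lengths of the words `ϱ(a)` are bounded on a compact alphabet. -/
theorem exists_length_bound (ϱ : Substitution A) : ∃ k : ℕ, ∀ a, ((ϱ a).1 : ℕ) ≤ k := by
  have hc : Continuous fun u : Word A => (u.1 : ℕ) :=
    continuous_sigma fun n => (continuous_const : Continuous fun _ : Fin (n : ℕ) → A => (n : ℕ))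
  obtain ⟨k, hk⟩ := (isCompact_range (hc.comp ϱ.continuous)).bddAbove
  exact ⟨k, fun a => hk ⟨a, rfl⟩⟩

/-- The substitution operator `(M f)(a) = ∑_{b ◁ ϱ(a)} f(b)` on `C(A, 𝕜)`. For `𝕜 = ℝ` this is
the operator `M` on `E = C(A, ℝ)`; for `𝕜 = ℂ` it is its complexification. -/
def substOp (𝕜 : Type*) [RCLike 𝕜] (ϱ : Substitution A) : C(A, 𝕜) →L[𝕜] C(A, 𝕜) :=
  LinearMap.mkContinuousOfExistsBound
    { toFun := fun f => ⟨fun a => wordSum f (ϱ a), (continuous_wordSum f).comp ϱ.continuous⟩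
      map_add' := fun f g => by
        ext a
        simp [wordSum, Finset.sum_add_distrib]
      map_smul' := fun c f => by
        ext a
        simp [wordSum, Finset.mul_sum] }
    (by
      obtain ⟨k, hk⟩ := exists_length_bound ϱ
      refine ⟨k, fun f => (ContinuousMap.norm_le _ (by positivity)).2 fun a => ?_⟩
      calc ‖∑ i, f ((ϱ a).2 i)‖ ≤ ∑ i : Fin ((ϱ a).1 : ℕ), ‖f ((ϱ a).2 i)‖ := norm_sum_le _ _
        _ ≤ ∑ _i : Fin ((ϱ a).1 : ℕ), ‖f‖ := Finset.sum_le_sum fun i _ => f.norm_coe_le_norm _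
        _ = ((ϱ a).1 : ℕ) * ‖f‖ := by simp
        _ ≤ k * ‖f‖ := by
          have := hk a
          gcongr)

theorem substOp_apply (𝕜 : Type*) [RCLike 𝕜] (ϱ : Substitution A) (f : C(A, 𝕜)) (a : A) :
    substOp 𝕜 ϱ f a = ∑ i, f ((ϱ a).2 i) := rfl

/-- The spectrum of the substitution operator, i.e. the set of all `λ ∈ ℂ` such that `λ - M` is
not invertible; as usual for an operator on a real Banach space, `M` is complexified. -/
def substSpectrum (ϱ : Substitution A) : Set ℂ := spectrum ℂ (substOp ℂ ϱ)

/-- The spectral radius `r` of the substitution operator. -/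
def substRadius (ϱ : Substitution A) : ℝ := (spectralRadius ℂ (substOp ℂ ϱ)).toReal

/-- `r₂ = sup {|λ| : λ ∈ σ(M), λ ≠ r}`, with `sup ∅ = 0`. -/
def secondRadius (ϱ : Substitution A) : ℝ :=
  sSup {x : ℝ | ∃ z ∈ substSpectrum ϱ, z ≠ (substRadius ϱ : ℂ) ∧ x = ‖z‖}

/-- The normalised substitution operator `T = M / r` on `E = C(A, ℝ)`. -/
def normOp (ϱ : Substitution A) : C(A, ℝ) →L[ℝ] C(A, ℝ) := (substRadius ϱ)⁻¹ • substOp ℝ ϱ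

/-- `Sⁿ` converges in the operator norm. -/
def UniformlyPowerConvergent (S : C(A, ℝ) →L[ℝ] C(A, ℝ)) : Prop :=
  ∃ P : C(A, ℝ) →L[ℝ] C(A, ℝ), Tendsto (fun n : ℕ => S ^ n) atTop (𝓝 P)

/-- `S` is (ideal) irreducible: the only `S`-invariant closed lattice ideals of the Banach lattice
`C(A, ℝ)` are the two trivial ones. -/
def IdealIrreducible (S : C(A, ℝ) →L[ℝ] C(A, ℝ)) : Prop :=
  ∀ I : Submodule ℝ C(A, ℝ), IsClosed (I : Set C(A, ℝ)) →
    (∀ f g : C(A, ℝ), g ∈ I → |f| ≤ |g| → f ∈ I) → (∀ f ∈ I, S f ∈ I) → I = ⊥ ∨ I = ⊤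

/-- `ℓ` is a non-zero natural length function of `ϱ` with inflation factor `r`, and `μ` is an
eigenmeasure (a positive functional on `C(A, ℝ)` fixed by the dual of `T`), scaled such that
`μ(ℓ) = 1`. -/
structure IsNormalisedEigenpair (ϱ : Substitution A) (ℓ : C(A, ℝ)) (μ : C(A, ℝ) →L[ℝ] ℝ) :
    Prop where
  length_nonneg : ∀ a, 0 ≤ ℓ a
  length_ne_zero : ℓ ≠ 0
  length_inflate : ∀ a, wordSum ℓ (ϱ a) = substRadius ϱ * ℓ a
  measure_nonneg : ∀ f : C(A, ℝ), 0 ≤ f → 0 ≤ μ f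
  measure_fixed : μ.comp (normOp ϱ) = μ
  normalised : μ ℓ = 1

end Operator

section Supertiles

variable {A : Type*} [TopologicalSpace A]

/-- The extension of `ϱ` to finite words by concatenation, `u₁⋯uₙ ↦ ϱ(u₁)⋯ϱ(uₙ)`. -/
def substWord (ϱ : Substitution A) (u : List A) : List A :=
  u.flatMap fun a => List.ofFn (ϱ a).2

/-- The level-`n` supertile `ϱⁿ(a)`. -/
def supertile (ϱ : Substitution A) (n : ℕ) (a : A) : List A := (substWord ϱ)^[n] [a]

/-- `Act(f, a, n) = ∑_{b ◁ ϱⁿ(a)} f(b)`, with multiplicity. -/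
def actualWeight (ϱ : Substitution A) (f : C(A, ℝ)) (a : A) (n : ℕ) : ℝ :=
  ((supertile ϱ n a).map f).sum

/-- `Exp(f, a, n) = rⁿ ℓ(a) μ(f)`. -/
def expectedWeight [CompactSpace A] (ϱ : Substitution A) (ℓ : C(A, ℝ)) (μ : C(A, ℝ) →L[ℝ] ℝ)
    (f : C(A, ℝ)) (a : A) (n : ℕ) : ℝ :=
  substRadius ϱ ^ n * ℓ a * μ f

theorem sum_map_substWord [CompactSpace A] (ϱ : Substitution A) (f : C(A, ℝ)) (u : List A) :
    ((substWord ϱ u).map f).sum = (u.map (substOp ℝ ϱ f)).sum := by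
  induction u with
  | nil => simp [substWord]
  | cons a u ih =>
    simp only [substWord, List.flatMap_cons, List.map_append, List.sum_append, List.map_cons,
      List.sum_cons] at ih ⊢
    rw [ih, substOp_apply, List.map_ofFn, List.sum_ofFn]
    rfl

/-- `Act(f, a, n) = (Mⁿ f)(a)`. -/
theorem actualWeight_eq [CompactSpace A] (ϱ : Substitution A) (f : C(A, ℝ)) (a : A) (n : ℕ) :
    actualWeight ϱ f a n = ((substOp ℝ ϱ) ^ n) f a := by
  have key : ∀ (n : ℕ) (f : C(A, ℝ)) (u : List A),
      (((substWord ϱ)^[n] u).map f).sum = (u.map (((substOp ℝ ϱ) ^ n) f)).sum := by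
    intro n
    induction n with
    | zero => intro f u; simp
    | succ n ih =>
      intro f u
      rw [Function.iterate_succ_apply', sum_map_substWord, ih, pow_succ]
      rfl
  simpa [actualWeight, supertile] using key n f [a]

end Supertiles

end

/-! Let `P` be the limit of `T ^ n`. Then `TP = PT = P = P²`, so `(M - rP) ^ n = M ^ n - r ^ n P`
for `n ≥ 1`: the error is a power of one operator. By a block decomposition along `P`, the nonzero
spectrum of `M - rP` lies in `σ(M)` (`mem_spectrum_of_mem_spectrum_sub`). Since `r⁻ⁿ (M - rP) ^ n`
tends to zero, `r` itself is excluded (`norm_lt_of_mem_spectrum_sub_limit`). So the spectral radius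
of `M - rP` is at most `r₂`, and Gelfand's formula gives the bound `(r₂ + ε) ^ n`.

For `r₂ > 0`, this yields the factor `θ`. If `σ(M) = {r}`, then `M` is invertible while `M - rP =
M(1 - P)` is quasinilpotent, which forces `P = 1`, and the error vanishes for `n ≥ 1`.

Irreducibility makes the fixed space of `T` a line spanned by a strictly positive function, so `P f
= μ(f) ℓ` (`IsNormalisedEigenpair.limit_apply`). The spectral part takes place over `ℂ`; the
estimates return to real functions by complexification. -/

/-! ### Limits of powers in a normed ring -/

theorem pow_mul_eq_of_mul_eq {R : Type*} [Monoid R] {t p : R} (h : t * p = p) (n : ℕ) : t ^ n * p = p := by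
  induction n with
  | zero => simp
  | succ n ih => rw [pow_succ, mul_assoc, h, ih]

section PowerLimits

variable {R : Type*} [NormedRing R] {t p : R}

theorem mul_eq_of_tendsto_pow (h : Tendsto (fun n : ℕ => t ^ n) atTop (𝓝 p)) : t * p = p :=
  tendsto_nhds_unique (h.const_mul t) <| by
    simpa only [← pow_succ', Function.comp_def] using h.comp (tendsto_add_atTop_nat 1)

theorem mul_eq_of_tendsto_pow' (h : Tendsto (fun n : ℕ => t ^ n) atTop (𝓝 p)) : p * t = p :=
  tendsto_nhds_unique (h.mul_const t) <| by
    simpa only [← pow_succ, Function.comp_def] using h.comp (tendsto_add_atTop_nat 1)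

theorem isIdempotentElem_of_tendsto_pow (h : Tendsto (fun n : ℕ => t ^ n) atTop (𝓝 p)) :
    p * p = p :=
  tendsto_nhds_unique (h.mul_const p) <| by
    simpa only [pow_mul_eq_of_mul_eq (mul_eq_of_tendsto_pow h)] using tendsto_const_nhds

end PowerLimits

/-- All mixed products of `t` and `p` collapse to `p`. The exponent is a successor because the
identity fails at exponent `0` unless `p = 0`. -/
theorem sub_pow_succ_of_absorbing {R : Type*} [Ring R] {t p : R} (h₁ : t * p = p)
    (h₂ : p * t = p) (hp : p * p = p) (n : ℕ) : (t - p) ^ (n + 1) = t ^ (n + 1) - p := by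
  induction n with
  | zero => simp
  | succ n ih => rw [pow_succ, ih, sub_mul, mul_sub, mul_sub, h₂, hp, pow_mul_eq_of_mul_eq h₁, ← pow_succ]; abel

/-! ### Spectral estimates in a complex Banach algebra -/

section BanachAlgebra

variable {B : Type*} [NormedRing B] [NormedAlgebra ℂ B]

theorem eventually_norm_pow_le_of_spectralRadius_le [CompleteSpace B] {a : B} {s : ℝ}
    (hs : 0 ≤ s) (h : spectralRadius ℂ a ≤ ENNReal.ofReal s) {ε : ℝ} (hε : 0 < ε) :
    ∀ᶠ n : ℕ in atTop, ‖a ^ n‖ ≤ (s + ε) ^ n := by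
  have hlt : spectralRadius ℂ a < ENNReal.ofReal (s + ε) :=
    h.trans_lt ((ENNReal.ofReal_lt_ofReal_iff (by linarith)).2 (by linarith))
  filter_upwards [(spectrum.pow_norm_pow_one_div_tendsto_nhds_spectralRadius a).eventually_lt_const
    hlt, eventually_ne_atTop 0] with n hn hn0
  have h1 := (ENNReal.ofReal_lt_ofReal_iff (by linarith)).1 hn
  calc ‖a ^ n‖ = (‖a ^ n‖ ^ (1 / n : ℝ)) ^ n := by
        rw [one_div, Real.rpow_inv_natCast_pow (norm_nonneg _) hn0]
    _ ≤ (s + ε) ^ n := by gcongr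

/-- As `z ^ n` lies in the spectrum of `a ^ n`, a single `n` with `‖a ^ n‖ * ‖1‖ < r ^ n` suffices.
The strict inequality later excludes `r` itself. -/
theorem norm_lt_of_mem_spectrum_of_tendsto_pow [CompleteSpace B] {a : B} {r : ℝ}
    (hr : 0 < r) (h : Tendsto (fun n : ℕ => ((r⁻¹ : ℝ) : ℂ) ^ n • a ^ n) atTop (𝓝 0)) {z : ℂ}
    (hz : z ∈ spectrum ℂ a) : ‖z‖ < r := by
  have h' : Tendsto (fun n : ℕ => ‖((r⁻¹ : ℝ) : ℂ) ^ n • a ^ n‖ * ‖(1 : B)‖) atTop (𝓝 0) := by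
    simpa using h.norm.mul_const ‖(1 : B)‖
  obtain ⟨n, hn⟩ := (h'.eventually_lt_const one_pos).exists
  have hn' : ‖a ^ n‖ * ‖(1 : B)‖ < r ^ n := by
    rw [norm_smul, norm_pow, Complex.norm_real, Real.norm_of_nonneg (by positivity), inv_pow,
      mul_assoc, inv_mul_lt_iff₀ (by positivity), mul_one] at hn
    exact hn
  have hz' : ‖z‖ ^ n < r ^ n := by
    rw [← norm_pow]
    exact (spectrum.norm_le_norm_mul_of_mem (spectrum.pow_mem_pow a n hz)).trans_lt hn'
  exact lt_of_pow_lt_pow_left₀ n hr.le hz'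

/-- Subtracting `r p` from `a`, where `p` is a spectral projection of `a` for the eigenvalue `r`,
does not change the spectrum away from `0` and `r`. -/
theorem mem_spectrum_of_mem_spectrum_sub {a p : B} {r z : ℂ} (h₁ : a * p = r • p)
    (h₂ : p * a = r • p) (hp : p * p = p) (hz0 : z ≠ 0) (hz : z ∈ spectrum ℂ (a - r • p)) :
    z ∈ spectrum ℂ a := by
  by_contra hza
  rw [spectrum.notMem_iff] at hza
  obtain ⟨u, hu⟩ := hza
  refine hz ?_
  rw [spectrum.mem_resolventSet_iff]
  rw [Algebra.algebraMap_eq_smul_one] at hu ⊢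
  have hup : Commute (↑u⁻¹ : B) p := by
    refine Commute.units_inv_left ?_
    rw [hu, commute_iff_eq, sub_mul, mul_sub, h₁, h₂]
    simp
  set v : B := ↑u⁻¹
  have hv1 : (z • 1 - a) * v = 1 := by rw [← hu]; exact u.mul_inv
  have hv2 : v * (z • 1 - a) = 1 := by rw [← hu]; exact u.inv_mul
  have e1 : (z • 1 - (a - r • p)) * p = z • p := by
    simp [sub_mul, h₁, hp]
  have e2 : p * (z • 1 - (a - r • p)) = z • p := by
    simp [mul_sub, h₂, hp]
  have e3 : (z • 1 - (a - r • p)) * (1 - p) = (z • 1 - a) * (1 - p) := by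
    rw [mul_sub, mul_sub, e1, sub_mul _ _ p, h₁, smul_mul_assoc, mul_one, mul_one, one_mul]; abel
  have e4 : (1 - p) * (z • 1 - (a - r • p)) = (1 - p) * (z • 1 - a) := by
    rw [sub_mul, sub_mul, e2, mul_sub p, h₂, mul_smul_comm, one_mul, one_mul, mul_one]; abel
  have hv : (1 - p) * v = v * (1 - p) := by rw [sub_mul, mul_sub, hup.eq, one_mul, mul_one]
  -- The element to invert acts as `z - a` on the block of `1 - p` and as `z` on the block of `p`;
  -- the witness is the sum of the two block inverses.
  refine isUnit_iff_exists.2 ⟨(1 - p) * v + z⁻¹ • p, ?_, ?_⟩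
  · rw [mul_add, ← mul_assoc, e3, mul_smul_comm, e1, smul_smul, inv_mul_cancel₀ hz0, one_smul,
      mul_assoc, hv, ← mul_assoc, hv1, one_mul, sub_add_cancel]
  · rw [add_mul, hv, mul_assoc, e4, smul_mul_assoc, e2, smul_smul, inv_mul_cancel₀ hz0, one_smul,
      ← mul_assoc, ← hv, mul_assoc, hv2, mul_one, sub_add_cancel]

/-- Here `a - r p = a (1 - p)`, so `1 - p` equals `a⁻ⁿ (a - r p) ^ n` for all `n ≥ 1`. The second
factor decays faster than any geometric sequence, hence `1 - p = 0`. -/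
theorem eq_zero_of_isUnit_of_quasinilpotent [CompleteSpace B] {a p : B} {r : ℂ}
    (h₁ : a * p = r • p) (h₂ : p * a = r • p) (hp : p * p = p) (ha : IsUnit a)
    (h : spectralRadius ℂ (a - r • p) ≤ 0) : a - r • p = 0 := by
  obtain ⟨u, rfl⟩ := ha
  set v : B := ↑u⁻¹
  have hup : Commute (u : B) p := by rw [commute_iff_eq, h₁, h₂]
  have hn : (u - r • p) = u * (1 - p) := by rw [mul_sub, h₁, mul_one]
  have hcomm : Commute (u : B) (1 - p) := (Commute.one_right _).sub_right hup
  have hid : IsIdempotentElem (1 - p) := IsIdempotentElem.one_sub hp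
  have hpow : ∀ n : ℕ, 1 - p = v ^ (n + 1) * (u - r • p) ^ (n + 1) := by
    intro n
    rw [hn, hcomm.mul_pow, hid.pow_succ_eq, ← mul_assoc, ← Units.val_pow_eq_pow_val,
      ← Units.val_pow_eq_pow_val, inv_pow, Units.inv_mul, one_mul]
  obtain ⟨ε, hε, hεv⟩ : ∃ ε : ℝ, 0 < ε ∧ ‖v‖ * ε < 1 := by
    refine ⟨(‖v‖ + 1)⁻¹, by positivity, ?_⟩
    rw [← div_eq_mul_inv, div_lt_one (by positivity)]
    linarith
  have hev := eventually_norm_pow_le_of_spectralRadius_le le_rfl (by simpa using h) hε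
  have hlim : Tendsto (fun n : ℕ => (‖v‖ * ε) ^ (n + 1)) atTop (𝓝 0) :=
    (tendsto_pow_atTop_nhds_zero_of_lt_one (by positivity) hεv).comp (tendsto_add_atTop_nat 1)
  have h0 : ‖1 - p‖ ≤ 0 := by
    refine ge_of_tendsto hlim ?_
    filter_upwards [(tendsto_add_atTop_nat 1).eventually hev] with n hn
    calc ‖1 - p‖ = ‖v ^ (n + 1) * (u - r • p) ^ (n + 1)‖ := congrArg _ (hpow n)
      _ ≤ ‖v‖ ^ (n + 1) * ε ^ (n + 1) := by
        refine (norm_mul_le _ _).trans ?_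
        gcongr
        · exact norm_pow_le' _ n.succ_pos
        · simpa using hn
      _ = _ := (mul_pow _ _ _).symm
  rw [hn, norm_le_zero_iff.1 h0, mul_zero]

end BanachAlgebra

/-- A sequence which is `O((s + ε)ⁿ)` for every `ε > 0` is bounded by a subexponential multiple
of `sⁿ`. -/
theorem exists_subexponential_bound {D : ℕ → ℝ} {s : ℝ} (hs : 0 < s)
    (h : ∀ ε : ℝ, 0 < ε → ∀ᶠ n : ℕ in atTop, D n ≤ (s + ε) ^ n) :
    ∃ θ : ℕ → ℝ, (∀ n, 0 < θ n) ∧ Tendsto (fun n : ℕ => θ n ^ (1 / (n : ℝ))) atTop (𝓝 1) ∧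
      ∀ n, D n ≤ θ n * s ^ n := by
  -- The maximum with `1` makes `θ` positive and keeps its roots at least `1`, so only the upper
  -- bound for the limit needs the hypothesis.
  refine ⟨fun n => max (D n / s ^ n) 1, fun n => by positivity, ?_, fun n => ?_⟩
  · refine tendsto_order.2 ⟨fun b hb => Eventually.of_forall fun n => hb.trans_le ?_,
      fun b hb => ?_⟩
    · exact Real.one_le_rpow (le_max_right _ _) (by positivity)
    · obtain ⟨c, hc1, hcb⟩ := exists_between hb
      have hc0 : 0 < c := one_pos.trans hc1
      filter_upwards [h (s * (c - 1)) (mul_pos hs (by linarith)), eventually_ne_atTop 0]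
        with n hn hn0
      refine lt_of_le_of_lt ?_ hcb
      rw [one_div, Real.rpow_inv_le_iff_of_pos (by positivity) hc0.le (by positivity),
        Real.rpow_natCast]
      refine max_le ?_ (one_le_pow₀ hc1.le)
      rw [div_le_iff₀ (by positivity), ← mul_pow, show c * s = s + s * (c - 1) by ring]
      exact hn
  · calc D n = D n / s ^ n * s ^ n := by field_simp
      _ ≤ _ := by gcongr; exact le_max_left _ _

/-! ### Powers of an element whose normalised powers converge -/

section Asymptotics

variable {B : Type*} [NormedRing B] [NormedAlgebra ℂ B] [CompleteSpace B] {a p : B}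

/-- The powers of `r⁻¹ a` tend to `p`. -/
def NormalisedPowersTendTo (a p : B) (r : ℝ) : Prop :=
  Tendsto (fun n : ℕ => (((r⁻¹ : ℝ) : ℂ) • a) ^ n) atTop (𝓝 p)

theorem ofReal_toReal_spectralRadius [NormOneClass B] (a : B) :
    ENNReal.ofReal (spectralRadius ℂ a).toReal = spectralRadius ℂ a :=
  ENNReal.ofReal_toReal (ne_top_of_le_ne_top ENNReal.coe_ne_top
    (spectrum.spectralRadius_le_nnnorm a))

theorem one_le_toReal_spectralRadius [NormOneClass B] (h : ∀ n : ℕ, 1 ≤ ‖a ^ n‖) :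
    1 ≤ (spectralRadius ℂ a).toReal := by
  by_contra! hlt
  have h0 : 0 ≤ (spectralRadius ℂ a).toReal := ENNReal.toReal_nonneg
  have hev := eventually_norm_pow_le_of_spectralRadius_le h0 (ofReal_toReal_spectralRadius a).ge
    (half_pos (sub_pos.2 hlt))
  obtain ⟨n, hn, hn1⟩ := (hev.and (eventually_ge_atTop 1)).exists
  have hpow : ((spectralRadius ℂ a).toReal + (1 - (spectralRadius ℂ a).toReal) / 2) ^ n < 1 :=
    pow_lt_one₀ (by linarith) (by linarith) (by omega)
  linarith [h n]

/-- The powers of an element, normalised by its spectral radius, do not tend to zero. -/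
theorem not_tendsto_normalised_pow_zero [Nontrivial B] (hr : 0 < (spectralRadius ℂ a).toReal) :
    ¬ NormalisedPowersTendTo a 0 (spectralRadius ℂ a).toReal := by
  intro h
  simp only [NormalisedPowersTendTo, smul_pow] at h
  -- The spectral radius is attained, whereas convergence to zero would put the whole spectrum
  -- strictly inside the disc of that radius.
  obtain ⟨z, hz, hzr⟩ := spectrum.exists_nnnorm_eq_spectralRadius a
  refine (norm_lt_of_mem_spectrum_of_tendsto_pow hr h hz).ne ?_
  rw [← hzr, ENNReal.coe_toReal, coe_nnnorm]

/-- The supremum of `‖z‖` over the points `z ≠ r` of the spectrum of `a`. -/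
noncomputable def spectralRadiusWithout (a : B) (r : ℝ) : ℝ :=
  sSup {x : ℝ | ∃ z ∈ spectrum ℂ a, z ≠ (r : ℂ) ∧ x = ‖z‖}

omit [CompleteSpace B] in
theorem spectralRadiusWithout_nonneg (a : B) (r : ℝ) : 0 ≤ spectralRadiusWithout a r :=
  Real.sSup_nonneg <| by
    rintro _ ⟨z, -, -, rfl⟩
    exact norm_nonneg z

theorem norm_le_spectralRadiusWithout {r : ℝ} {z : ℂ} (hz : z ∈ spectrum ℂ a) (hzr : z ≠ r) :
    ‖z‖ ≤ spectralRadiusWithout a r := by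
  refine le_csSup ⟨‖a‖ * ‖(1 : B)‖, ?_⟩ ⟨z, hz, hzr, rfl⟩
  rintro _ ⟨w, hw, -, rfl⟩
  exact spectrum.norm_le_norm_mul_of_mem hw

section Limit

variable {r : ℝ} (hr : 0 < r) (h : NormalisedPowersTendTo a p r)
include hr h

omit [CompleteSpace B]

theorem mul_limit_eq_smul : a * p = (r : ℂ) • p := by
  have := mul_eq_of_tendsto_pow h
  rw [smul_mul_assoc, Complex.ofReal_inv] at this
  rwa [← inv_smul_eq_iff₀ (Complex.ofReal_ne_zero.2 hr.ne')]

theorem limit_mul_eq_smul : p * a = (r : ℂ) • p := by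
  have := mul_eq_of_tendsto_pow' h
  rw [mul_smul_comm, Complex.ofReal_inv] at this
  rwa [← inv_smul_eq_iff₀ (Complex.ofReal_ne_zero.2 hr.ne')]

theorem sub_smul_pow_of_tendsto {n : ℕ} (hn : n ≠ 0) :
    (a - (r : ℂ) • p) ^ n = a ^ n - (r : ℂ) ^ n • p := by
  obtain ⟨n, rfl⟩ := Nat.exists_eq_succ_of_ne_zero hn
  have hr0 : (r : ℂ) ≠ 0 := Complex.ofReal_ne_zero.2 hr.ne'
  have e : a - (r : ℂ) • p = (r : ℂ) • (((r⁻¹ : ℝ) : ℂ) • a - p) := by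
    rw [smul_sub, smul_smul, Complex.ofReal_inv, mul_inv_cancel₀ hr0, one_smul]
  rw [e, smul_pow, sub_pow_succ_of_absorbing (mul_eq_of_tendsto_pow h)
    (mul_eq_of_tendsto_pow' h) (isIdempotentElem_of_tendsto_pow h), smul_sub, smul_pow, smul_smul,
    ← mul_pow, Complex.ofReal_inv, mul_inv_cancel₀ hr0, one_pow, one_smul]

theorem ofReal_mem_spectrum_of_tendsto (hp : p ≠ 0) : (r : ℂ) ∈ spectrum ℂ a := by
  intro hu
  rw [spectrum.mem_resolventSet_iff] at hu
  refine hp (hu.mul_left_cancel ?_)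
  rw [mul_zero, sub_mul, mul_limit_eq_smul hr h, Algebra.algebraMap_eq_smul_one, smul_mul_assoc,
    one_mul, sub_self]

variable [CompleteSpace B]

/-- The powers of `a - r p`, divided by `r ^ n`, tend to `p - p = 0`. -/
theorem norm_lt_of_mem_spectrum_sub_limit {z : ℂ} (hz : z ∈ spectrum ℂ (a - (r : ℂ) • p)) :
    ‖z‖ < r := by
  refine norm_lt_of_mem_spectrum_of_tendsto_pow hr ?_ hz
  have hlim : Tendsto (fun n : ℕ => (((r⁻¹ : ℝ) : ℂ) • a) ^ n - p) atTop (𝓝 0) := by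
    simpa using Tendsto.sub_const h p
  refine hlim.congr' ?_
  filter_upwards [eventually_ne_atTop 0] with n hn
  rw [sub_smul_pow_of_tendsto hr h hn, smul_sub, smul_smul, ← mul_pow, Complex.ofReal_inv,
    inv_mul_cancel₀ (Complex.ofReal_ne_zero.2 hr.ne'), one_pow, one_smul, smul_pow]

theorem spectralRadius_sub_limit_le :
    spectralRadius ℂ (a - (r : ℂ) • p) ≤ ENNReal.ofReal (spectralRadiusWithout a r) := by
  refine iSup₂_le fun z hz => ?_
  change ‖z‖ₑ ≤ _
  rw [← ofReal_norm]
  refine ENNReal.ofReal_le_ofReal ?_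
  rcases eq_or_ne z 0 with rfl | hz0
  · rw [norm_zero]
    exact spectralRadiusWithout_nonneg a r
  refine norm_le_spectralRadiusWithout (mem_spectrum_of_mem_spectrum_sub (mul_limit_eq_smul hr h)
    (limit_mul_eq_smul hr h) (isIdempotentElem_of_tendsto_pow h) hz0 hz) ?_
  rintro rfl
  have := norm_lt_of_mem_spectrum_sub_limit hr h hz
  rw [Complex.norm_real, Real.norm_of_nonneg hr.le] at this
  exact this.false

theorem eventually_norm_pow_sub_limit_le {ε : ℝ} (hε : 0 < ε) :
    ∀ᶠ n : ℕ in atTop, ‖a ^ n - (r : ℂ) ^ n • p‖ ≤ (spectralRadiusWithout a r + ε) ^ n := by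
  filter_upwards [eventually_norm_pow_le_of_spectralRadius_le (spectralRadiusWithout_nonneg a r)
    (spectralRadius_sub_limit_le hr h) hε, eventually_ne_atTop 0] with n hn hn0
  rwa [← sub_smul_pow_of_tendsto hr h hn0]

theorem exists_norm_pow_sub_limit_le (hp : p ≠ 0) (hσ : spectrum ℂ a ≠ {0, (r : ℂ)}) :
    ∃ θ : ℕ → ℝ, (∀ n, 0 < θ n) ∧ Tendsto (fun n : ℕ => θ n ^ (1 / (n : ℝ))) atTop (𝓝 1) ∧
      ∀ n, ‖a ^ n - (r : ℂ) ^ n • p‖ ≤ θ n * spectralRadiusWithout a r ^ n := by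
  rcases (spectralRadiusWithout_nonneg a r).lt_or_eq with hs | hs
  · exact exists_subexponential_bound hs fun ε hε => eventually_norm_pow_sub_limit_le hr h hε
  -- With second radius zero, the spectrum is contained in `{0, r}` and contains `r`; being
  -- different from `{0, r}`, it omits `0`.
  have hunit : IsUnit a := by
    by_contra hu
    refine hσ (Set.Subset.antisymm (fun z hz => ?_) ?_)
    · by_cases hzr : z = r
      · exact Or.inr hzr
      · have := norm_le_spectralRadiusWithout hz hzr
        rw [← hs] at this
        exact Or.inl (norm_le_zero_iff.1 this)
    · rintro z (rfl | rfl)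
      · exact (spectrum.zero_mem_iff ℂ).2 hu
      · exact ofReal_mem_spectrum_of_tendsto hr h hp
  have hzero : a - (r : ℂ) • p = 0 := by
    refine eq_zero_of_isUnit_of_quasinilpotent (mul_limit_eq_smul hr h)
      (limit_mul_eq_smul hr h) (isIdempotentElem_of_tendsto_pow h) hunit ?_
    simpa [← hs] using spectralRadius_sub_limit_le hr h
  have hpow : ∀ n : ℕ, n ≠ 0 → a ^ n - (r : ℂ) ^ n • p = 0 := fun n hn => by
    rw [← sub_smul_pow_of_tendsto hr h hn, hzero, zero_pow hn]
  -- The error vanishes for `n ≠ 0`, so `θ n = 1` there. At `n = 0`, `0 ^ 0 = 1` and `θ 0` must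
  -- absorb the error.
  refine ⟨fun n => max ‖a ^ n - (r : ℂ) ^ n • p‖ 1, fun n => by positivity, ?_, fun n => ?_⟩
  · refine tendsto_const_nhds.congr' ?_
    filter_upwards [eventually_ne_atTop 0] with n hn
    simp [hpow n hn]
  · rcases eq_or_ne n 0 with rfl | hn
    · simp
    · simp [hpow n hn, ← hs, hn]

end Limit

end Asymptotics

/-! ### Complexification of operators on `C(A, ℝ)` -/

noncomputable section Complexification

variable {A : Type*} [TopologicalSpace A]

/-- The pointwise real part of a continuous function. -/
def reMap (f : C(A, ℂ)) : C(A, ℝ) := ⟨fun a => (f a).re, by fun_prop⟩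

/-- The pointwise imaginary part of a continuous function. -/
def imMap (f : C(A, ℂ)) : C(A, ℝ) := ⟨fun a => (f a).im, by fun_prop⟩

/-- A real continuous function, seen as a complex one. -/
def ofRealMap (f : C(A, ℝ)) : C(A, ℂ) := ⟨fun a => (f a : ℂ), by fun_prop⟩

@[simp] theorem reMap_apply (f : C(A, ℂ)) (a : A) : reMap f a = (f a).re := rfl
@[simp] theorem imMap_apply (f : C(A, ℂ)) (a : A) : imMap f a = (f a).im := rfl
@[simp] theorem ofRealMap_apply (f : C(A, ℝ)) (a : A) : ofRealMap f a = (f a : ℂ) := rfl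

theorem reMap_add (f g : C(A, ℂ)) : reMap (f + g) = reMap f + reMap g := by ext; simp
theorem imMap_add (f g : C(A, ℂ)) : imMap (f + g) = imMap f + imMap g := by ext; simp
theorem reMap_smul (c : ℂ) (f : C(A, ℂ)) :
    reMap (c • f) = c.re • reMap f - c.im • imMap f := by ext; simp
theorem imMap_smul (c : ℂ) (f : C(A, ℂ)) :
    imMap (c • f) = c.re • imMap f + c.im • reMap f := by ext; simp
@[simp] theorem reMap_ofRealMap (f : C(A, ℝ)) : reMap (ofRealMap f) = f := by ext; simp
@[simp] theorem imMap_ofRealMap (f : C(A, ℝ)) : imMap (ofRealMap f) = 0 := by ext; simp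

variable [CompactSpace A]

theorem norm_reMap_le (f : C(A, ℂ)) : ‖reMap f‖ ≤ ‖f‖ :=
  (ContinuousMap.norm_le _ (norm_nonneg _)).2 fun a =>
    (Complex.abs_re_le_norm _).trans (f.norm_coe_le_norm a)

theorem norm_imMap_le (f : C(A, ℂ)) : ‖imMap f‖ ≤ ‖f‖ :=
  (ContinuousMap.norm_le _ (norm_nonneg _)).2 fun a =>
    (Complex.abs_im_le_norm _).trans (f.norm_coe_le_norm a)

theorem norm_ofRealMap (f : C(A, ℝ)) : ‖ofRealMap f‖ = ‖f‖ := by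
  refine le_antisymm ?_ ?_
  · refine (ContinuousMap.norm_le _ (norm_nonneg _)).2 fun a => ?_
    simpa using f.norm_coe_le_norm a
  · simpa using norm_reMap_le (ofRealMap f)

/-- The complexification of a bounded operator on `C(A, ℝ)`. -/
def complexify (S : C(A, ℝ) →L[ℝ] C(A, ℝ)) : C(A, ℂ) →L[ℂ] C(A, ℂ) :=
  LinearMap.mkContinuous
    { toFun := fun f => ofRealMap (S (reMap f)) + Complex.I • ofRealMap (S (imMap f))
      map_add' := fun f g => by
        ext a
        simp only [reMap_add, imMap_add, map_add, ContinuousMap.add_apply,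
          ContinuousMap.smul_apply, ofRealMap_apply, Complex.ofReal_add, smul_eq_mul]
        ring
      map_smul' := fun c f => by
        ext a
        apply Complex.ext <;> simp [reMap_smul, imMap_smul, sub_eq_add_neg, add_comm] }
    (2 * ‖S‖)
    (fun f => by
      refine (norm_add_le _ _).trans ?_
      have h1 : ‖S (reMap f)‖ ≤ ‖S‖ * ‖f‖ := S.le_opNorm_of_le (norm_reMap_le f)
      have h2 : ‖S (imMap f)‖ ≤ ‖S‖ * ‖f‖ := S.le_opNorm_of_le (norm_imMap_le f)
      simp only [norm_smul, norm_ofRealMap, Complex.norm_I]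
      linarith)

theorem complexify_apply (S : C(A, ℝ) →L[ℝ] C(A, ℝ)) (f : C(A, ℂ)) :
    complexify S f = ofRealMap (S (reMap f)) + Complex.I • ofRealMap (S (imMap f)) := rfl

theorem reMap_complexify (S : C(A, ℝ) →L[ℝ] C(A, ℝ)) (f : C(A, ℂ)) :
    reMap (complexify S f) = S (reMap f) := by
  ext; simp [complexify_apply]

theorem imMap_complexify (S : C(A, ℝ) →L[ℝ] C(A, ℝ)) (f : C(A, ℂ)) :
    imMap (complexify S f) = S (imMap f) := by
  ext; simp [complexify_apply]

theorem complexify_ofRealMap (S : C(A, ℝ) →L[ℝ] C(A, ℝ)) (f : C(A, ℝ)) :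
    complexify S (ofRealMap f) = ofRealMap (S f) := by
  ext; simp [complexify_apply]

theorem complexify_mul (S U : C(A, ℝ) →L[ℝ] C(A, ℝ)) :
    complexify (S * U) = complexify S * complexify U := by
  ext f a
  simp only [mul_apply_eq_comp, complexify_apply (S * U), complexify_apply S,
    reMap_complexify, imMap_complexify]

theorem complexify_one : complexify (1 : C(A, ℝ) →L[ℝ] C(A, ℝ)) = 1 := by
  ext f a
  apply Complex.ext <;> simp [complexify_apply]

theorem complexify_pow (S : C(A, ℝ) →L[ℝ] C(A, ℝ)) (n : ℕ) :
    complexify (S ^ n) = complexify S ^ n := by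
  induction n with
  | zero => simp [complexify_one]
  | succ n ih => rw [pow_succ, complexify_mul, ih, pow_succ]

theorem complexify_sub (S U : C(A, ℝ) →L[ℝ] C(A, ℝ)) :
    complexify (S - U) = complexify S - complexify U := by
  ext f a
  apply Complex.ext <;> simp [complexify_apply]

theorem complexify_smul (c : ℝ) (S : C(A, ℝ) →L[ℝ] C(A, ℝ)) :
    complexify (c • S) = (c : ℂ) • complexify S := by
  ext f a
  apply Complex.ext <;> simp [complexify_apply]

theorem norm_complexify_le (S : C(A, ℝ) →L[ℝ] C(A, ℝ)) : ‖complexify S‖ ≤ 2 * ‖S‖ :=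
  LinearMap.mkContinuous_norm_le _ (by positivity) _

/-- Real functions embed isometrically, so complex bounds descend with constant `1`. -/
theorem norm_apply_le_norm_complexify (S : C(A, ℝ) →L[ℝ] C(A, ℝ)) (f : C(A, ℝ)) :
    ‖S f‖ ≤ ‖complexify S‖ * ‖f‖ := by
  simpa only [complexify_ofRealMap, norm_ofRealMap] using (complexify S).le_opNorm (ofRealMap f)

theorem tendsto_complexify {ι : Type*} {F : Filter ι} {S : ι → C(A, ℝ) →L[ℝ] C(A, ℝ)}
    {U : C(A, ℝ) →L[ℝ] C(A, ℝ)} (h : Tendsto S F (𝓝 U)) :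
    Tendsto (fun i => complexify (S i)) F (𝓝 (complexify U)) := by
  refine (tendsto_iff_norm_sub_tendsto_zero (E := C(A, ℂ) →L[ℂ] C(A, ℂ))).2 ?_
  replace h := (tendsto_iff_norm_sub_tendsto_zero (E := C(A, ℝ) →L[ℝ] C(A, ℝ))).1 h
  refine squeeze_zero (fun _ => norm_nonneg _) (fun i => ?_) (by simpa using h.const_mul 2)
  rw [← complexify_sub]
  exact norm_complexify_le _

theorem complexify_substOp (ϱ : Substitution A) : complexify (substOp ℝ ϱ) = substOp ℂ ϱ := by
  ext f a
  apply Complex.ext <;> simp [complexify_apply, substOp_apply]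

end Complexification

/-! ### Positivity and irreducibility -/

section PositiveOperator

variable {A : Type*} [TopologicalSpace A]

/-- The continuous functions which vanish on `Z`. -/
def vanishingOn (Z : Set A) : Submodule ℝ C(A, ℝ) where
  carrier := {f | ∀ a ∈ Z, f a = 0}
  add_mem' := fun hf hg a ha => by simp [hf a ha, hg a ha]
  zero_mem' := fun a _ => rfl
  smul_mem' := fun c f hf a ha => by simp [hf a ha]

theorem mem_vanishingOn {Z : Set A} {f : C(A, ℝ)} : f ∈ vanishingOn Z ↔ ∀ a ∈ Z, f a = 0 :=
  Iff.rfl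

theorem isClosed_vanishingOn (Z : Set A) : IsClosed (vanishingOn Z : Set C(A, ℝ)) := by
  have h : (vanishingOn Z : Set C(A, ℝ)) = ⋂ a ∈ Z, {f : C(A, ℝ) | f a = 0} := by
    ext f
    simp [mem_vanishingOn]
  rw [h]
  exact isClosed_biInter fun a _ => isClosed_eq (ContinuousEvalConst.continuous_eval_const a)
    continuous_const

variable [CompactSpace A]

theorem normOp_apply (ϱ : Substitution A) (f : C(A, ℝ)) (a : A) :
    normOp ϱ f a = (substRadius ϱ)⁻¹ * ∑ i, f ((ϱ a).2 i) := rfl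

theorem normOp_nonneg (ϱ : Substitution A) {f : C(A, ℝ)} (hf : ∀ a, 0 ≤ f a) (a : A) :
    0 ≤ normOp ϱ f a := by
  rw [normOp_apply]
  exact mul_nonneg (inv_nonneg.2 ENNReal.toReal_nonneg) (Finset.sum_nonneg fun i _ => hf _)

theorem normOp_pow_nonneg (ϱ : Substitution A) {f : C(A, ℝ)} (hf : ∀ a, 0 ≤ f a) (n : ℕ) (a : A) :
    0 ≤ (normOp ϱ ^ n) f a := by
  induction n generalizing a with
  | zero => simpa using hf a
  | succ n ih => rw [pow_succ']; exact normOp_nonneg ϱ ih a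

/-- Words are non-empty, so one letter already contributes at least `1`. This leads to `r ≥ 1`,
which makes division by `r` legitimate. -/
theorem one_le_substOp_pow (ϱ : Substitution A) (n : ℕ) (a : A) :
    1 ≤ (substOp ℝ ϱ ^ n) 1 a := by
  induction n generalizing a with
  | zero => simp
  | succ n ih =>
    rw [pow_succ', mul_apply_eq_comp, substOp_apply]
    let i₀ : Fin ((ϱ a).1 : ℕ) := ⟨0, (ϱ a).1.pos⟩
    exact (ih ((ϱ a).2 i₀)).trans <| Finset.single_le_sum
      (f := fun i => (substOp ℝ ϱ ^ n) 1 ((ϱ a).2 i))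
      (fun i _ => zero_le_one.trans (ih _)) (Finset.mem_univ i₀)

variable [Nonempty A]

theorem one_le_norm_substOp_pow (ϱ : Substitution A) (n : ℕ) : 1 ≤ ‖substOp ℂ ϱ ^ n‖ := by
  obtain ⟨a⟩ := ‹Nonempty A›
  rw [← complexify_substOp, ← complexify_pow]
  calc (1 : ℝ) ≤ (substOp ℝ ϱ ^ n) 1 a := one_le_substOp_pow ϱ n a
    _ ≤ ‖(substOp ℝ ϱ ^ n) 1‖ :=
      (le_abs_self _).trans (((substOp ℝ ϱ ^ n) 1).norm_coe_le_norm a)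
    _ ≤ _ := (norm_apply_le_norm_complexify _ _).trans_eq (by rw [norm_one, mul_one])

theorem one_le_substRadius (ϱ : Substitution A) : 1 ≤ substRadius ϱ := by
  unfold substRadius
  exact one_le_toReal_spectralRadius (B := C(A, ℂ) →L[ℂ] C(A, ℂ)) (a := substOp ℂ ϱ)
    (one_le_norm_substOp_pow ϱ)

theorem substRadius_pos (ϱ : Substitution A) : 0 < substRadius ϱ :=
  one_pos.trans_le (one_le_substRadius ϱ)

theorem normOp_apply_eq_self_iff (ϱ : Substitution A) (f : C(A, ℝ)) :
    normOp ϱ f = f ↔ ∀ a, wordSum f (ϱ a) = substRadius ϱ * f a := by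
  simp only [ContinuousMap.ext_iff, normOp_apply, wordSum,
    inv_mul_eq_iff_eq_mul₀ (substRadius_pos ϱ).ne']

/-- Non-zero non-negative fixed points of an irreducible operator are strictly positive. -/
theorem IdealIrreducible.pos_of_fixed {ϱ : Substitution A} (h : IdealIrreducible (normOp ϱ))
    {f : C(A, ℝ)} (hf : ∀ a, 0 ≤ f a) (hf0 : f ≠ 0) (hfix : normOp ϱ f = f) (a : A) :
    0 < f a := by
  -- This ideal is invariant: where `f` vanishes at `b`, the fixed-point equation makes a
  -- non-negative sum zero, so `f` vanishes at every letter of `ϱ(b)`. It contains `f ≠ 0`, hence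
  -- also `1`, and so the zero set is empty.
  have hI := h (vanishingOn {a | f a = 0}) (isClosed_vanishingOn _) ?_ ?_
  · rcases hI with hI | hI
    · have hmem : f ∈ vanishingOn {a | f a = 0} := fun a ha => ha
      rw [hI] at hmem
      exact absurd hmem hf0
    · refine (hf a).lt_of_ne' fun ha => ?_
      have hmem : (1 : C(A, ℝ)) ∈ vanishingOn {a | f a = 0} := hI ▸ Submodule.mem_top
      exact one_ne_zero (hmem a ha)
  · intro g k hk hgk a ha
    have habs : |g a| ≤ |k a| := hgk a
    rw [hk a ha, abs_zero] at habs
    exact abs_eq_zero.1 (habs.antisymm (abs_nonneg _))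
  · intro g hg b hb
    rw [normOp_apply]
    have hsum : ∑ i, f ((ϱ b).2 i) = 0 := by
      have := (normOp_apply_eq_self_iff ϱ f).1 hfix b
      rwa [show f b = 0 from hb, mul_zero] at this
    rw [Finset.sum_eq_zero_iff_of_nonneg fun i _ => hf _] at hsum
    rw [Finset.sum_eq_zero fun i hi => hg _ (hsum i hi), mul_zero]

/-- The fixed space of an irreducible operator is at most one-dimensional. -/
theorem IdealIrreducible.exists_smul_eq {ϱ : Substitution A} (h : IdealIrreducible (normOp ϱ))
    {f g : C(A, ℝ)} (hf : ∀ a, 0 < f a) (hfix : normOp ϱ f = f) (hg : normOp ϱ g = g) :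
    ∃ c : ℝ, g = c • f := by
  have hc : Continuous fun a => g a / f a :=
    g.continuous.div f.continuous fun a => (hf a).ne'
  -- Subtracting the minimum of `g / f` times `f` leaves a non-negative fixed point with a zero at
  -- `a₀`; by strict positivity it must vanish.
  obtain ⟨a₀, -, ha₀⟩ := isCompact_univ.exists_isMinOn Set.univ_nonempty hc.continuousOn
  refine ⟨g a₀ / f a₀, ?_⟩
  by_contra hne
  have hpos := h.pos_of_fixed (f := g - (g a₀ / f a₀) • f) (fun a => ?_) (sub_ne_zero.2 hne)
    (by rw [map_sub, map_smul, hfix, hg]) a₀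
  · simp [(hf a₀).ne'] at hpos
  · have := (le_div_iff₀ (hf a)).1 (ha₀ (Set.mem_univ a))
    simpa using this

end PositiveOperator

/-! ### The limit projection and the error term -/

section PowerConvergent

variable {A : Type*} [TopologicalSpace A] [CompactSpace A] {ϱ : Substitution A}
  {P : C(A, ℝ) →L[ℝ] C(A, ℝ)}

theorem limit_nonneg (hP : Tendsto (fun n : ℕ => normOp ϱ ^ n) atTop (𝓝 P)) {f : C(A, ℝ)}
    (hf : ∀ a, 0 ≤ f a) (a : A) : 0 ≤ P f a := by
  have hlim : Tendsto (fun n : ℕ => (normOp ϱ ^ n) f a) atTop (𝓝 (P f a)) :=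
    (((continuous_eval_const a).comp
      (ContinuousLinearMap.apply ℝ C(A, ℝ) f).continuous).tendsto P).comp hP
  exact ge_of_tendsto' hlim fun n => normOp_pow_nonneg ϱ hf n a

theorem normOp_eq_inv_smul_complexify (ϱ : Substitution A) :
    complexify (normOp ϱ) = (((substRadius ϱ)⁻¹ : ℝ) : ℂ) • substOp ℂ ϱ := by
  rw [normOp, complexify_smul, complexify_substOp]

theorem tendsto_complexify_normOp_pow (hP : Tendsto (fun n : ℕ => normOp ϱ ^ n) atTop (𝓝 P)) :
    NormalisedPowersTendTo (B := C(A, ℂ) →L[ℂ] C(A, ℂ)) (substOp ℂ ϱ) (complexify P)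
      (substRadius ϱ) := by
  unfold NormalisedPowersTendTo
  simpa only [complexify_pow, normOp_eq_inv_smul_complexify] using tendsto_complexify hP

theorem secondRadius_eq (ϱ : Substitution A) : secondRadius ϱ =
    spectralRadiusWithout (B := C(A, ℂ) →L[ℂ] C(A, ℂ)) (substOp ℂ ϱ) (substRadius ϱ) := rfl

theorem normOp_limit (hP : Tendsto (fun n : ℕ => normOp ϱ ^ n) atTop (𝓝 P)) (f : C(A, ℝ)) :
    normOp ϱ (P f) = P f := DFunLike.congr_fun (mul_eq_of_tendsto_pow (R := C(A, ℝ) →L[ℝ] C(A, ℝ)) hP) f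

theorem fixed_functional_limit (hP : Tendsto (fun n : ℕ => normOp ϱ ^ n) atTop (𝓝 P))
    {μ : C(A, ℝ) →L[ℝ] ℝ} (hμ : μ.comp (normOp ϱ) = μ) (f : C(A, ℝ)) : μ (P f) = μ f := by
  have hlim : Tendsto (fun n : ℕ => μ ((normOp ϱ ^ n) f)) atTop (𝓝 (μ (P f))) :=
    ((μ.continuous.comp (ContinuousLinearMap.apply ℝ C(A, ℝ) f).continuous).tendsto P).comp hP
  refine tendsto_nhds_unique hlim ?_
  have hconst : ∀ n : ℕ, μ ((normOp ϱ ^ n) f) = μ f := by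
    intro n
    induction n with
    | zero => simp
    | succ n ih =>
      rw [pow_succ', mul_apply_eq_comp, ← ih]
      exact DFunLike.congr_fun hμ _
  simpa only [hconst] using tendsto_const_nhds

variable [Nonempty A]

theorem complexify_limit_ne_zero (hP : Tendsto (fun n : ℕ => normOp ϱ ^ n) atTop (𝓝 P)) :
    complexify P ≠ 0 := fun h =>
  not_tendsto_normalised_pow_zero (B := C(A, ℂ) →L[ℂ] C(A, ℂ)) (a := substOp ℂ ϱ)
    (substRadius_pos ϱ)
    (h ▸ tendsto_complexify_normOp_pow hP)

theorem limit_ne_zero (hP : Tendsto (fun n : ℕ => normOp ϱ ^ n) atTop (𝓝 P)) : P ≠ 0 := by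
  rintro rfl
  refine complexify_limit_ne_zero hP ?_
  ext f a
  simp [complexify_apply]

/-- By positivity, `P f` lies between `-‖f‖ • P 1` and `‖f‖ • P 1`, so `P 1 = 0` would force `P =
0`. -/
theorem limit_one_ne_zero (hP : Tendsto (fun n : ℕ => normOp ϱ ^ n) atTop (𝓝 P)) : P 1 ≠ 0 := by
  intro h1
  refine limit_ne_zero hP (ContinuousLinearMap.ext fun f => ContinuousMap.ext fun a => ?_)
  have hbd : ∀ a, |f a| ≤ ‖f‖ := f.norm_coe_le_norm
  have hu := limit_nonneg hP (f := ‖f‖ • 1 - f)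
    (fun a => by simpa using (abs_le.1 (hbd a)).2) a
  have hl := limit_nonneg hP (f := ‖f‖ • 1 + f)
    (fun a => by simpa using by linarith [(abs_le.1 (hbd a)).1]) a
  rw [map_sub, map_smul, h1] at hu
  rw [map_add, map_smul, h1] at hl
  simp at hu hl ⊢
  exact le_antisymm hu hl

theorem exists_isNormalisedEigenpair (hA2 : IdealIrreducible (normOp ϱ))
    (hP : Tendsto (fun n : ℕ => normOp ϱ ^ n) atTop (𝓝 P)) :
    ∃ (ℓ : C(A, ℝ)) (μ : C(A, ℝ) →L[ℝ] ℝ), IsNormalisedEigenpair ϱ ℓ μ := by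
  obtain ⟨a₀⟩ := id ‹Nonempty A›
  have hfix := normOp_limit hP 1
  have hnn : ∀ a, 0 ≤ P 1 a := limit_nonneg hP fun a => zero_le_one
  have hpos := hA2.pos_of_fixed hnn (limit_one_ne_zero hP) hfix
  -- Any `a₀` serves, since `P 1` is strictly positive. Invariance of the functional comes from `P T
  -- = P`, its normalisation from `P² = P`.
  refine ⟨P 1, (P 1 a₀)⁻¹ • (ContinuousMap.evalCLM ℝ a₀).comp P, hnn, limit_one_ne_zero hP,
    (normOp_apply_eq_self_iff ϱ _).1 hfix, fun f hf => ?_, ?_, ?_⟩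
  · exact mul_nonneg (inv_nonneg.2 (hnn a₀)) (limit_nonneg hP hf a₀)
  · ext f
    have := DFunLike.congr_fun (mul_eq_of_tendsto_pow' (R := C(A, ℝ) →L[ℝ] C(A, ℝ)) hP) f
    rw [mul_apply_eq_comp] at this
    simp [this]
  · have := DFunLike.congr_fun (isIdempotentElem_of_tendsto_pow (R := C(A, ℝ) →L[ℝ] C(A, ℝ)) hP) (1 : C(A, ℝ))
    rw [mul_apply_eq_comp] at this
    simp [this, (hpos a₀).ne']

/-- The limit of the powers of `T` is the projection `f ↦ μ(f) ℓ`. -/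
theorem IsNormalisedEigenpair.limit_apply {ℓ : C(A, ℝ)} {μ : C(A, ℝ) →L[ℝ] ℝ}
    (h : IsNormalisedEigenpair ϱ ℓ μ) (hA2 : IdealIrreducible (normOp ϱ))
    (hP : Tendsto (fun n : ℕ => normOp ϱ ^ n) atTop (𝓝 P)) (f : C(A, ℝ)) : P f = μ f • ℓ := by
  have hfix := (normOp_apply_eq_self_iff ϱ ℓ).2 h.length_inflate
  have hpos := hA2.pos_of_fixed h.length_nonneg h.length_ne_zero hfix
  obtain ⟨c, hc⟩ := hA2.exists_smul_eq hpos hfix (normOp_limit hP f)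
  have hμ := fixed_functional_limit hP h.measure_fixed f
  rw [hc, map_smul, h.normalised, smul_eq_mul, mul_one] at hμ
  rw [hc, hμ]

/-- As `μ(f) ℓ = P f`, the error is, up to sign, the value at `a` of `(M ^ n - r ^ n P) f`; an
operator norm bound is uniform in `f` and `a`. -/
theorem IsNormalisedEigenpair.abs_expected_sub_actual_le {ℓ : C(A, ℝ)} {μ : C(A, ℝ) →L[ℝ] ℝ}
    (h : IsNormalisedEigenpair ϱ ℓ μ) (hA2 : IdealIrreducible (normOp ϱ))
    (hP : Tendsto (fun n : ℕ => normOp ϱ ^ n) atTop (𝓝 P)) {f : C(A, ℝ)} (hf : ‖f‖ ≤ 1) (a : A)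
    (n : ℕ) : |expectedWeight ϱ ℓ μ f a n - actualWeight ϱ f a n| ≤
      ‖substOp ℂ ϱ ^ n - (substRadius ϱ : ℂ) ^ n • complexify P‖ := by
  set S := substOp ℝ ϱ ^ n - substRadius ϱ ^ n • P with hS
  have e : substOp ℂ ϱ ^ n - (substRadius ϱ : ℂ) ^ n • complexify P = complexify S := by
    rw [hS, complexify_sub, complexify_pow, complexify_substOp, complexify_smul,
      Complex.ofReal_pow]
  have e' : actualWeight ϱ f a n - expectedWeight ϱ ℓ μ f a n = S f a := by
    rw [hS, actualWeight_eq, expectedWeight]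
    simp [h.limit_apply hA2 hP f]
    ring
  rw [e, abs_sub_comm, e']
  calc |S f a| ≤ ‖S f‖ := (S f).norm_coe_le_norm a
    _ ≤ ‖complexify S‖ * ‖f‖ := norm_apply_le_norm_complexify S f
    _ ≤ ‖complexify S‖ := mul_le_of_le_one_right (norm_nonneg _) hf

theorem eventually_norm_substOp_pow_sub_limit_le
    (hP : Tendsto (fun n : ℕ => normOp ϱ ^ n) atTop (𝓝 P)) {ε : ℝ} (hε : 0 < ε) :
    ∀ᶠ n : ℕ in atTop, ‖substOp ℂ ϱ ^ n - (substRadius ϱ : ℂ) ^ n • complexify P‖ ≤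
      (secondRadius ϱ + ε) ^ n := by
  have key := eventually_norm_pow_sub_limit_le (B := C(A, ℂ) →L[ℂ] C(A, ℂ)) (a := substOp ℂ ϱ)
    (p := complexify P) (r := substRadius ϱ) (substRadius_pos ϱ)
    (tendsto_complexify_normOp_pow hP) hε
  rw [secondRadius_eq]
  exact key.mono fun n hn => hn

theorem exists_norm_substOp_pow_sub_limit_le
    (hP : Tendsto (fun n : ℕ => normOp ϱ ^ n) atTop (𝓝 P))
    (hσ : substSpectrum ϱ ≠ {0, (substRadius ϱ : ℂ)}) :
    ∃ θ : ℕ → ℝ, (∀ n, 0 < θ n) ∧ Tendsto (fun n : ℕ => θ n ^ (1 / (n : ℝ))) atTop (𝓝 1) ∧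
      ∀ n, ‖substOp ℂ ϱ ^ n - (substRadius ϱ : ℂ) ^ n • complexify P‖ ≤
        θ n * secondRadius ϱ ^ n := by
  rw [secondRadius_eq]
  exact exists_norm_pow_sub_limit_le (B := C(A, ℂ) →L[ℂ] C(A, ℂ)) (a := substOp ℂ ϱ)
    (p := complexify P) (r := substRadius ϱ) (substRadius_pos ϱ)
    (tendsto_complexify_normOp_pow hP) (complexify_limit_ne_zero hP) hσ

end PowerConvergent

/-! ### The main theorem -/

theorem mainTheorem6 {A : Type*} [TopologicalSpace A] [CompactSpace A] [T2Space A] [Nonempty A]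
    (ϱ : Substitution A) (hA1 : UniformlyPowerConvergent (normOp ϱ))
    (hA2 : IdealIrreducible (normOp ϱ)) :
    (∃ (ℓ : C(A, ℝ)) (μ : C(A, ℝ) →L[ℝ] ℝ), IsNormalisedEigenpair ϱ ℓ μ) ∧
    ∀ (ℓ : C(A, ℝ)) (μ : C(A, ℝ) →L[ℝ] ℝ), IsNormalisedEigenpair ϱ ℓ μ →
      (substSpectrum ϱ ≠ {0, (substRadius ϱ : ℂ)} →
        ∃ θ : ℕ → ℝ, (∀ n, 0 < θ n) ∧
          Tendsto (fun n : ℕ => θ n ^ (1 / (n : ℝ))) atTop (𝓝 1) ∧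
          ∀ (f : C(A, ℝ)), ‖f‖ ≤ 1 → ∀ (a : A) (n : ℕ),
            |expectedWeight ϱ ℓ μ f a n - actualWeight ϱ f a n| ≤ θ n * secondRadius ϱ ^ n) ∧
      (∀ ε : ℝ, 0 < ε → ∀ᶠ n : ℕ in atTop, ∀ (f : C(A, ℝ)), ‖f‖ ≤ 1 → ∀ a : A,
        |expectedWeight ϱ ℓ μ f a n - actualWeight ϱ f a n| ≤ (secondRadius ϱ + ε) ^ n) := by
  obtain ⟨P, hP⟩ := hA1
  refine ⟨exists_isNormalisedEigenpair hA2 hP, fun ℓ μ h => ⟨fun hσ => ?_, fun ε hε => ?_⟩⟩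
  · obtain ⟨θ, hθ, hlim, hbd⟩ := exists_norm_substOp_pow_sub_limit_le hP hσ
    exact ⟨θ, hθ, hlim, fun f hf a n =>
      (h.abs_expected_sub_actual_le hA2 hP hf a n).trans (hbd n)⟩
  · filter_upwards [eventually_norm_substOp_pow_sub_limit_le hP hε] with n hn f hf a
    exact (h.abs_expected_sub_actual_le hA2 hP hf a n).trans hn
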